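/- For real $\alpha>-1$ and $x>0$ let $$I_\alpha(x)=\sum_{k=0}^{\infty}\frac{(x/2)^{2k+\alpha}}{k!\,\Gamma(k+\alpha+1)}$$ be the modified Bessel function of the first kind. Let $\mu>-1$, $q>-1$ and $0<\gamma<1$ be real, and for $x>0$ put $$R_{\mu,q,\gamma}(x)=\frac{\int_0^x e^{-\gamma t}\,t^{q-\mu}I_\mu(t)\,dt}{e^{-\gamma x}\,x^{q-\mu}I_{\mu+1}(x)},\qquad M^*_{\mu,q,\gamma}=\sup_{x>0}R_{\mu,q,\gamma}(x).$$ The integrals converge, and the following hold. (i) As $x\downarrow0$, $$R_{\mu,q,\gamma}(x)=\frac{2(\mu+1)}{q+1}\left[1+\frac{\gamma x}{q+2}+\left\{\frac{\gamma^2}{(q+2)(q+3)}+\frac{q+1}{4(\mu+1)(q+3)}-\frac{1}{4(\mu+2)}\right\}x^2+O(x^3)\right].$$ (ii) As $x\to\infty$, $$R_{\mu,q,\gamma}(x)=\frac1{1-\gamma}+\frac{(\mu+1/2)(2-\gamma)-q}{(1-\gamma)^2x}+O(x^{-2}).$$ (iii) $M^*_{\mu,q,\gamma}$ is finite and $M^*_{\mu,q,\gamma}>\dfrac{2(\mu+1)}{q+1}$.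 If moreover $q<(\mu+1/2)(2-\gamma)$, then also $M^*_{\mu,q,\gamma}>\dfrac1{1-\gamma}$. The constants implied in the $O$-terms may depend on $\mu,q,\gamma$. -/

import Mathlib

open Filter Topology Asymptotics

noncomputable section

/-- The modified Bessel function of the first kind `I_α(x)` of real order `α`, for `x > 0`, by its
power series `∑ₖ (x/2)^(2k+α) / (k! Γ(k+α+1))`. (At a pole of `Γ` the term is `0`, in agreement
with the usual convention `1/Γ = 0` there.) -/
def besselI (α x : ℝ) : ℝ :=
  ∑' k : ℕ, (x / 2) ^ (2 * (k : ℝ) + α) / ((k.factorial : ℝ) * Real.Gamma ((k : ℝ) + α + 1))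

/-- The integrand `exp(-γ t) t^(q-μ) I_μ(t)`. -/
def quotientIntegrand (μ q γ t : ℝ) : ℝ :=
  Real.exp (-(γ * t)) * t ^ (q - μ) * besselI μ t

/-- The quotient `R_{μ,q,γ}(x)`, for `x > 0`. -/
def sharpQuotient (μ q γ x : ℝ) : ℝ :=
  (∫ t in (0 : ℝ)..x, quotientIntegrand μ q γ t) /
    (Real.exp (-(γ * x)) * x ^ (q - μ) * besselI (μ + 1) x)

/-- The sharp constant `M*_{μ,q,γ} = sup_{x>0} R_{μ,q,γ}(x)`. -/
def sharpConstant (μ q γ : ℝ) : ℝ :=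
  sSup (sharpQuotient μ q γ '' Set.Ioi 0)

end

/-!
The quotient `R` solves the linear equation `R' = k - (k - γ + (q - 2μ - 1) / x) R`, in which the
ratio `k = I_μ / I_{μ+1}` solves the Riccati equation `k' = 1 - k² + (2μ + 1) k / x`. Subtract from
`k`, or from `R`, the expansion at infinity that the equation suggests: the difference satisfies
`z' = -A z + B` with `A` eventually bounded below by a positive constant and `B = O(x⁻²)`, and such
an equation forces `z = O(x⁻²)`.

At the origin, once the powers of `x` are taken out, `R` is a moment `∫₀ˣ t^q φ(t) dt / x^(q+1)` of
an entire function divided by an entire function that does not vanish there, so the expansion is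
found by integrating and dividing Taylor polynomials.

Finally `R` is continuous with finite limits at both ends, hence bounded, and a positive
first-order coefficient at an end makes `R` exceed its limit there.
-/

/-! ### The Bessel–Clifford function -/

/-- The coefficients `1 / (k! Γ(k+α+1))` of the Bessel–Clifford function `besselClifford α`, equal
to `0` at the poles of `Γ`. -/
noncomputable def besselCoeff (α : ℝ) (k : ℕ) : ℝ :=
  1 / ((k.factorial : ℝ) * Real.Gamma ((k : ℝ) + α + 1))

/-- The Bessel–Clifford function `C_α(z) = ∑ₖ z^k / (k! Γ(k+α+1))`, the entire function for which
`I_α(x) = (x/2)^α C_α(x²/4)`. -/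
noncomputable def besselClifford (α z : ℝ) : ℝ :=
  FormalMultilinearSeries.ofScalarsSum (besselCoeff α) z

theorem besselCoeff_pos {α : ℝ} {k : ℕ} (h : 0 < (k : ℝ) + α + 1) : 0 < besselCoeff α k := by
  have := Real.Gamma_pos_of_pos h
  unfold besselCoeff
  positivity

theorem succ_mul_besselCoeff_succ (α : ℝ) (k : ℕ) :
    ((k : ℝ) + 1) * besselCoeff α (k + 1) = besselCoeff (α + 1) k := by
  have hΓ : (k : ℝ) + 1 + α + 1 = k + (α + 1) + 1 := by ring
  simp only [besselCoeff, Nat.factorial_succ, Nat.cast_mul, Nat.cast_succ, hΓ]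
  field_simp

theorem besselCoeff_eq_mul (α : ℝ) (k : ℕ) :
    besselCoeff α k = ((k : ℝ) + α + 1) * besselCoeff (α + 1) k := by
  rcases eq_or_ne ((k : ℝ) + α + 1) 0 with h | h
  · simp [besselCoeff, h]
  · rw [besselCoeff, besselCoeff, show (k : ℝ) + (α + 1) + 1 = (k + α + 1) + 1 by ring,
      Real.Gamma_add_one h]
    field_simp

theorem norm_besselCoeff (α : ℝ) (k : ℕ) :
    ‖besselCoeff α k‖ = ‖Complex.regularizedHGFunCoeff 0 {(α + 1 : ℂ)} k‖ := by
  rw [← Complex.norm_real]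
  simp [besselCoeff, Complex.regularizedHGFunCoeff, ← Complex.Gamma_ofReal, add_comm, add_assoc,
    add_left_comm]

theorem radius_ofScalars_besselCoeff (α : ℝ) :
    (FormalMultilinearSeries.ofScalars ℝ (besselCoeff α)).radius = ⊤ := by
  have hradius := Complex.radius_regularizedHGFunSeries_eq_top
    (show (0 : Multiset ℂ).card ≤ ({(α + 1 : ℂ)} : Multiset ℂ).card by simp)
  refine top_le_iff.mp (hradius ▸ FormalMultilinearSeries.radius_le_of_le fun k => ?_)
  rw [Complex.regularizedHGFunSeries, FormalMultilinearSeries.ofScalars_norm,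
    FormalMultilinearSeries.ofScalars_norm, norm_besselCoeff]

theorem hasFPowerSeriesOnBall_besselClifford (α : ℝ) :
    HasFPowerSeriesOnBall (besselClifford α)
      (FormalMultilinearSeries.ofScalars ℝ (besselCoeff α)) 0 ⊤ := by
  have h := radius_ofScalars_besselCoeff α
  exact h ▸ FormalMultilinearSeries.hasFPowerSeriesOnBall _ (by simp [h])

theorem hasSum_besselClifford (α z : ℝ) :
    HasSum (fun k : ℕ => besselCoeff α k * z ^ k) (besselClifford α z) := by
  simpa [mul_comm] using
    (hasFPowerSeriesOnBall_besselClifford α).hasSum (y := z) (by simp)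

theorem hasDerivAt_besselClifford (α z : ℝ) :
    HasDerivAt (besselClifford α) (besselClifford (α + 1) z) z := by
  have hseries := hasFPowerSeriesOnBall_besselClifford α
  have hdiff : DifferentiableAt ℝ (besselClifford α) z :=
    (hseries.analyticAt_of_mem (by simp)).differentiableAt
  have hderiv : HasSum (fun k : ℕ => besselCoeff (α + 1) k * z ^ k)
      (deriv (besselClifford α) z) := by
    have h := (hseries.fderiv.hasSum (y := z) (by simp)).mapL
      (ContinuousLinearMap.apply ℝ ℝ (1 : ℝ))
    simpa [← succ_mul_besselCoeff_succ, mul_comm, mul_left_comm, mul_assoc] using h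
  rw [(hasSum_besselClifford (α + 1) z).unique hderiv]
  exact hdiff.hasDerivAt

theorem continuous_besselClifford (α : ℝ) : Continuous (besselClifford α) :=
  continuous_iff_continuousAt.mpr fun z => (hasDerivAt_besselClifford α z).continuousAt

theorem besselClifford_pos {α z : ℝ} (hα : -1 < α) (hz : 0 ≤ z) : 0 < besselClifford α z := by
  have hcoeff (k : ℕ) : 0 < besselCoeff α k :=
    besselCoeff_pos (by linarith [k.cast_nonneg (α := ℝ)])
  have hsum := hasSum_besselClifford α z
  rw [← hsum.tsum_eq]
  refine hsum.summable.tsum_pos (fun k => mul_nonneg (hcoeff k).le (pow_nonneg hz k)) 0 ?_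
  simpa using hcoeff 0

theorem besselClifford_recurrence (α z : ℝ) :
    besselClifford α z = (α + 1) * besselClifford (α + 1) z + z * besselClifford (α + 2) z := by
  have hshift : HasSum (fun k : ℕ => (k : ℝ) * besselCoeff (α + 1) k * z ^ k)
      (z * besselClifford (α + 2) z) := by
    rw [← hasSum_nat_add_iff' 1]
    have h := (hasSum_besselClifford (α + 1 + 1) z).mul_left z
    simp only [← succ_mul_besselCoeff_succ (α + 1)] at h
    rw [show α + 1 + 1 = α + 2 by ring] at h
    simpa [pow_succ, mul_comm, mul_left_comm, mul_assoc] using h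
  refine (hasSum_besselClifford α z).unique
    ((((hasSum_besselClifford (α + 1) z).mul_left (α + 1)).add hshift).congr_fun fun k => ?_)
  rw [besselCoeff_eq_mul α k]
  ring

theorem besselClifford_sub_sum_isBigO (α : ℝ) (n : ℕ) :
    (fun z => besselClifford α z - ∑ k ∈ Finset.range n, besselCoeff α k * z ^ k)
      =O[𝓝 0] fun z => z ^ n := by
  have h := (hasFPowerSeriesOnBall_besselClifford α).hasFPowerSeriesAt.isBigO_sub_partialSum_pow n
  simp only [← norm_pow] at h
  refine h.of_norm_right.congr_left fun z => ?_
  simp [FormalMultilinearSeries.partialSum, mul_comm]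

/-! ### Modified Bessel functions -/

theorem besselI_eq {α x : ℝ} (hx : 0 < x) :
    besselI α x = (x / 2) ^ α * besselClifford α (x ^ 2 / 4) := by
  rw [besselI, ← (hasSum_besselClifford α _).tsum_eq, ← tsum_mul_left]
  refine tsum_congr fun k => ?_
  have hpow : (x / 2) ^ (2 * (k : ℝ)) = (x ^ 2 / 4) ^ k := by
    rw [show 2 * (k : ℝ) = ((2 * k : ℕ) : ℝ) by push_cast; ring, Real.rpow_natCast, pow_mul]
    ring
  rw [Real.rpow_add (by positivity), hpow, besselCoeff]
  ring

theorem besselI_pos {α x : ℝ} (hα : -1 < α) (hx : 0 < x) : 0 < besselI α x := by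
  rw [besselI_eq hx]
  have := besselClifford_pos hα (z := x ^ 2 / 4) (by positivity)
  positivity

theorem besselI_recurrence {α x : ℝ} (hx : 0 < x) :
    besselI α x = 2 * (α + 1) / x * besselI (α + 1) x + besselI (α + 2) x := by
  have hx2 : 0 < x / 2 := by positivity
  rw [besselI_eq hx, besselI_eq hx, besselI_eq hx, besselClifford_recurrence,
    Real.rpow_add hx2, Real.rpow_add hx2, Real.rpow_one, Real.rpow_two]
  field_simp
  ring

theorem hasDerivAt_besselI {α x : ℝ} (hx : 0 < x) :
    HasDerivAt (besselI α) (α / x * besselI α x + besselI (α + 1) x) x := by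
  have hx2 : 0 < x / 2 := by positivity
  have hsq : HasDerivAt (fun y : ℝ => y ^ 2 / 4) (x / 2) x := by
    refine ((hasDerivAt_pow 2 x).div_const 4).congr_deriv ?_
    norm_num
    ring
  have hpow : HasDerivAt (fun y : ℝ => (y / 2) ^ α) (1 / 2 * α * (x / 2) ^ (α - 1)) x :=
    ((hasDerivAt_id x).div_const 2).rpow_const (Or.inl hx2.ne')
  have hprod := hpow.mul ((hasDerivAt_besselClifford α (x ^ 2 / 4)).comp x hsq)
  refine (hprod.congr_of_eventuallyEq ?_).congr_deriv ?_
  · filter_upwards [eventually_gt_nhds hx] with y hy using besselI_eq hy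
  · rw [besselI_eq hx, besselI_eq hx, Real.rpow_add hx2, Real.rpow_one,
      Real.rpow_sub_one hx2.ne', Function.comp_apply]
    field_simp

theorem hasDerivAt_besselI_succ {α x : ℝ} (hx : 0 < x) :
    HasDerivAt (besselI (α + 1)) (besselI α x - (α + 1) / x * besselI (α + 1) x) x := by
  refine (hasDerivAt_besselI hx).congr_deriv ?_
  rw [besselI_recurrence (α := α) hx, show α + 1 + 1 = α + 2 by ring]
  ring

/-- The ratio `I_α(x) / I_{α+1}(x)`, taken in this orientation because it is the inhomogeneous term
of the linear equation for the quotient. -/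
noncomputable def besselRatio (α x : ℝ) : ℝ :=
  besselI α x / besselI (α + 1) x

theorem besselRatio_pos {α x : ℝ} (hα : -1 < α) (hx : 0 < x) : 0 < besselRatio α x :=
  div_pos (besselI_pos hα hx) (besselI_pos (by linarith) hx)

theorem hasDerivAt_besselRatio {α x : ℝ} (hx : 0 < x) (hI : besselI (α + 1) x ≠ 0) :
    HasDerivAt (besselRatio α)
      (1 - besselRatio α x ^ 2 + (2 * α + 1) / x * besselRatio α x) x := by
  refine ((hasDerivAt_besselI hx).div (hasDerivAt_besselI_succ hx) hI).congr_deriv ?_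
  unfold besselRatio
  field_simp
  ring

/-! ### Damped linear equations -/

theorem le_of_hasDerivAt_of_lt_mul {z A B : ℝ → ℝ} {x₀ x M : ℝ}
    (hz : ∀ y ≥ x₀, HasDerivAt z (-A y * z y + B y) y) (hM : z x₀ ≤ M)
    (hB : ∀ y ≥ x₀, B y < A y * M) (hx : x₀ ≤ x) : z x ≤ M := by
  refine image_le_of_deriv_right_lt_deriv_boundary (B := fun _ => M) (B' := fun _ => 0)
    (fun y hy => (hz y hy.1).continuousAt.continuousWithinAt)
    (fun y hy => (hz y hy.1).hasDerivWithinAt) hM (fun y => hasDerivAt_const y M)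
    (fun y hy hzy => ?_) (Set.right_mem_Icc.mpr hx)
  rw [hzy]
  linarith [hB y hy.1]

theorem isBigO_one_of_hasDerivAt_damped {z A B : ℝ → ℝ} {a : ℝ} (ha : 0 < a)
    (hz : ∀ᶠ x in atTop, HasDerivAt z (-A x * z x + B x) x) (hA : ∀ᶠ x in atTop, a ≤ A x)
    (hB : B =O[atTop] fun _ => (1 : ℝ)) : z =O[atTop] fun _ => (1 : ℝ) := by
  obtain ⟨C, hC0, hC⟩ := hB.exists_pos
  obtain ⟨x₀, h₀⟩ := eventually_atTop.mp (hz.and (hA.and hC.bound))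
  set M : ℝ := |z x₀| + C / a + 1 with hM
  have hCM : C < a * M := by
    have : a * M = a * |z x₀| + C + a := by rw [hM]; field_simp
    linarith [mul_nonneg ha.le (abs_nonneg (z x₀))]
  have hzM : |z x₀| ≤ M := by linarith [div_pos hC0 ha]
  have hBM : ∀ y ≥ x₀, |B y| < A y * M := fun y hy => by
    have hBC : |B y| ≤ C := by simpa using (h₀ y hy).2.2
    have hAM : a * M ≤ A y * M :=
      mul_le_mul_of_nonneg_right (h₀ y hy).2.1 ((abs_nonneg _).trans hzM)
    linarith
  refine IsBigO.of_bound M ?_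
  filter_upwards [eventually_ge_atTop x₀] with x hx
  rw [norm_one, mul_one, Real.norm_eq_abs, abs_le']
  constructor
  · exact le_of_hasDerivAt_of_lt_mul (fun y hy => (h₀ y hy).1) ((le_abs_self _).trans hzM)
      (fun y hy => (le_abs_self _).trans_lt (hBM y hy)) hx
  · exact le_of_hasDerivAt_of_lt_mul (z := fun y => -z y) (B := fun y => -B y)
      (fun y hy => (h₀ y hy).1.neg.congr_deriv (by ring)) ((neg_le_abs _).trans hzM)
      (fun y hy => (neg_le_abs _).trans_lt (hBM y hy)) hx

theorem tendsto_const_div_atTop (c : ℝ) : Tendsto (fun x : ℝ => c / x) atTop (𝓝 0) :=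
  tendsto_const_nhds.div_atTop tendsto_id

/-- Passing to `x ^ n * y x` lowers the damping only by `n / x`. -/
theorem isBigO_inv_pow_of_hasDerivAt_damped {y A B : ℝ → ℝ} {a : ℝ} (n : ℕ) (ha : 0 < a)
    (hy : ∀ᶠ x in atTop, HasDerivAt y (-A x * y x + B x) x) (hA : ∀ᶠ x in atTop, a ≤ A x)
    (hB : B =O[atTop] fun x => 1 / x ^ n) : y =O[atTop] fun x => 1 / x ^ n := by
  have hscaled : (fun x => x ^ n * y x) =O[atTop] fun _ => (1 : ℝ) := by
    refine isBigO_one_of_hasDerivAt_damped (A := fun x => A x - n / x)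
      (B := fun x => x ^ n * B x) (half_pos ha) ?_ ?_ ?_
    · filter_upwards [hy, eventually_gt_atTop 0] with x hx hx0
      refine ((hasDerivAt_pow n x).mul hx).congr_deriv ?_
      rcases n with _ | n
      · simp
      · rw [Nat.add_sub_cancel]
        field_simp
        ring
    · filter_upwards [hA, (tendsto_const_div_atTop n).eventually_le_const (half_pos ha)]
        with x hAx hnx
      linarith
    · refine ((isBigO_refl (fun x : ℝ => x ^ n) atTop).mul hB).trans_eventuallyEq ?_
      filter_upwards [eventually_gt_atTop 0] with x hx
      field_simp
  refine ((isBigO_refl (fun x : ℝ => 1 / x ^ n) atTop).mul hscaled).congr' ?_ (by simp)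
  filter_upwards [eventually_gt_atTop 0] with x hx
  field_simp

/-! ### The ratio of modified Bessel functions at infinity -/

theorem eventually_half_le_besselRatio_add_one_sub {α : ℝ} (hα : -1 < α) :
    ∀ᶠ x in atTop, 1 / 2 ≤ besselRatio α x + 1 - (2 * α + 1) / x := by
  filter_upwards [(tendsto_const_div_atTop (2 * α + 1)).eventually_le_const one_half_pos,
    eventually_gt_atTop 0] with x hle hx
  linarith [besselRatio_pos hα hx]

theorem besselRatio_sub_one_isBigO {α : ℝ} (hα : -1 < α) :
    (fun x => besselRatio α x - 1) =O[atTop] fun x => 1 / x ^ 1 := by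
  refine isBigO_inv_pow_of_hasDerivAt_damped
    (A := fun x => besselRatio α x + 1 - (2 * α + 1) / x) (B := fun x => (2 * α + 1) / x)
    1 one_half_pos ?_ (eventually_half_le_besselRatio_add_one_sub hα) ?_
  · filter_upwards [eventually_gt_atTop 0] with x hx
    refine ((hasDerivAt_besselRatio hx (besselI_pos (by linarith) hx).ne').sub_const
      1).congr_deriv ?_
    ring
  · exact ((isBigO_refl (fun x : ℝ => 1 / x ^ 1) atTop).const_mul_left (2 * α + 1)).congr_left
      fun x => by ring

theorem besselRatio_sub_isBigO {α : ℝ} (hα : -1 < α) :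
    (fun x => besselRatio α x - (1 + (α + 1 / 2) / x)) =O[atTop] fun x => 1 / x ^ 2 := by
  refine isBigO_inv_pow_of_hasDerivAt_damped
    (A := fun x => besselRatio α x + 1 - (2 * α + 1) / x)
    (B := fun x => -(α + 1 / 2) * (1 / x ^ 1 * (besselRatio α x - 1))
      + (α + 1 / 2) * (2 * α + 2) * (1 / x ^ 2))
    2 one_half_pos ?_ (eventually_half_le_besselRatio_add_one_sub hα) ?_
  · filter_upwards [eventually_gt_atTop 0] with x hx
    have hmain := ((hasDerivAt_inv hx.ne').const_mul (α + 1 / 2)).const_add 1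
    refine ((hasDerivAt_besselRatio hx (besselI_pos (by linarith) hx).ne').sub
      hmain).congr_deriv ?_
    field_simp
    ring
  · refine IsBigO.add (IsBigO.const_mul_left ?_ _) ((isBigO_refl _ _).const_mul_left _)
    exact ((isBigO_refl (fun x : ℝ => 1 / x ^ 1) atTop).mul
      (besselRatio_sub_one_isBigO hα)).congr_right fun x => by ring

theorem tendsto_besselRatio_atTop {α : ℝ} (hα : -1 < α) :
    Tendsto (besselRatio α) atTop (𝓝 1) := by
  have hsub := (besselRatio_sub_one_isBigO hα).trans_tendsto
    (by simpa using tendsto_const_div_atTop 1)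
  simpa using hsub.add_const 1

/-! ### The quotient -/

/-- The entire function `e^{-γt} C_α(t²/4)` left of `e^{-γt} I_α(t)` once the power `(t/2)^α` is
taken out. -/
noncomputable def besselWeight (α γ t : ℝ) : ℝ :=
  Real.exp (-(γ * t)) * besselClifford α (t ^ 2 / 4)

theorem continuous_besselWeight (α γ : ℝ) : Continuous (besselWeight α γ) := by
  have := continuous_besselClifford α
  unfold besselWeight
  fun_prop

theorem besselWeight_pos {α : ℝ} (hα : -1 < α) (γ t : ℝ) : 0 < besselWeight α γ t :=
  mul_pos (Real.exp_pos _) (besselClifford_pos hα (by positivity))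

theorem exp_mul_rpow_mul_besselI {α γ s t : ℝ} (ht : 0 < t) :
    Real.exp (-(γ * t)) * t ^ s * besselI α t
      = (1 / 2) ^ α * (t ^ (s + α) * besselWeight α γ t) := by
  rw [besselI_eq ht, besselWeight, Real.rpow_add ht, div_eq_mul_one_div t 2,
    Real.mul_rpow ht.le one_half_pos.le]
  ring

theorem quotientIntegrand_eq {μ q γ t : ℝ} (ht : 0 < t) :
    quotientIntegrand μ q γ t = (1 / 2) ^ μ * (t ^ q * besselWeight μ γ t) := by
  rw [quotientIntegrand, exp_mul_rpow_mul_besselI ht, sub_add_cancel]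

theorem intervalIntegrable_rpow_mul_of_continuous {q : ℝ} (hq : -1 < q) {φ : ℝ → ℝ}
    (hφ : Continuous φ) (a b : ℝ) :
    IntervalIntegrable (fun t => t ^ q * φ t) MeasureTheory.volume a b :=
  (intervalIntegral.intervalIntegrable_rpow' hq).mul_continuousOn hφ.continuousOn

theorem intervalIntegrable_quotientIntegrand {μ q γ x : ℝ} (hq : -1 < q) (hx : 0 < x) :
    IntervalIntegrable (quotientIntegrand μ q γ) MeasureTheory.volume 0 x := by
  refine ((intervalIntegrable_rpow_mul_of_continuous hq (continuous_besselWeight μ γ) 0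
    x).const_mul ((1 / 2) ^ μ)).congr fun t ht => ?_
  rw [Set.uIoc_of_le hx.le] at ht
  exact (quotientIntegrand_eq ht.1).symm

theorem integral_quotientIntegrand {μ q γ x : ℝ} (hx : 0 < x) :
    ∫ t in (0 : ℝ)..x, quotientIntegrand μ q γ t
      = (1 / 2) ^ μ * ∫ t in (0 : ℝ)..x, t ^ q * besselWeight μ γ t := by
  rw [← intervalIntegral.integral_const_mul]
  refine intervalIntegral.integral_congr_ae (Eventually.of_forall fun t ht => ?_)
  rw [Set.uIoc_of_le hx.le] at ht
  exact quotientIntegrand_eq ht.1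

theorem sharpQuotient_eq {μ q γ x : ℝ} (hx : 0 < x) :
    sharpQuotient μ q γ x = 2 * ((∫ t in (0 : ℝ)..x, t ^ q * besselWeight μ γ t) / x ^ (q + 1))
      / besselWeight (μ + 1) γ x := by
  have hhalf : (0 : ℝ) < (1 / 2) ^ μ := by positivity
  rw [sharpQuotient, integral_quotientIntegrand hx, exp_mul_rpow_mul_besselI hx,
    show q - μ + (μ + 1) = q + 1 by ring, Real.rpow_add_one one_half_pos.ne', mul_assoc,
    mul_div_mul_left _ _ hhalf.ne']
  simp only [div_eq_mul_inv, mul_inv, inv_inv, one_mul]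
  ring

theorem continuousAt_quotientIntegrand {μ q γ x : ℝ} (hx : 0 < x) :
    ContinuousAt (quotientIntegrand μ q γ) x := by
  refine ContinuousAt.mul (ContinuousAt.mul (by fun_prop) ?_)
    (hasDerivAt_besselI hx).continuousAt
  exact continuousAt_id.rpow_const (Or.inl hx.ne')

theorem hasDerivAt_integral_quotientIntegrand {μ q γ x : ℝ} (hq : -1 < q) (hx : 0 < x) :
    HasDerivAt (fun y => ∫ t in (0 : ℝ)..y, quotientIntegrand μ q γ t)
      (quotientIntegrand μ q γ x) x := by
  have hcont : ContinuousOn (quotientIntegrand μ q γ) (Set.Ioi 0) := fun y hy =>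
    (continuousAt_quotientIntegrand hy).continuousWithinAt
  exact intervalIntegral.integral_hasDerivAt_right (intervalIntegrable_quotientIntegrand hq hx)
    (hcont.stronglyMeasurableAtFilter isOpen_Ioi x hx) (continuousAt_quotientIntegrand hx)

/-- The coefficient `A` in the linear equation `R' = -A R + I_μ / I_{μ+1}` satisfied by the quotient
`R = R_{μ,q,γ}`. -/
noncomputable def quotientDamping (μ q γ x : ℝ) : ℝ :=
  besselRatio μ x - γ + (q - 2 * μ - 1) / x

theorem hasDerivAt_sharpQuotient {μ q γ x : ℝ} (hq : -1 < q) (hx : 0 < x)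
    (hI : besselI (μ + 1) x ≠ 0) :
    HasDerivAt (sharpQuotient μ q γ)
      (-quotientDamping μ q γ x * sharpQuotient μ q γ x + besselRatio μ x) x := by
  have hp := (Real.rpow_pos_of_pos hx (q - μ)).ne'
  have hexp : HasDerivAt (fun y : ℝ => Real.exp (-(γ * y))) (Real.exp (-(γ * x)) * -γ) x := by
    simpa using ((hasDerivAt_id x).const_mul γ).neg.exp
  have hpow : HasDerivAt (fun y : ℝ => y ^ (q - μ)) ((q - μ) * (x ^ (q - μ) / x)) x := by
    simpa only [Real.rpow_sub_one hx.ne'] using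
      Real.hasDerivAt_rpow_const (p := q - μ) (Or.inl hx.ne')
  have hdenom := (hexp.mul hpow).mul (hasDerivAt_besselI_succ (α := μ) hx)
  refine ((hasDerivAt_integral_quotientIntegrand hq hx).div hdenom
    (mul_ne_zero (mul_ne_zero (Real.exp_ne_zero _) hp) hI)).congr_deriv ?_
  simp only [sharpQuotient, Pi.mul_apply, quotientDamping, besselRatio]
  generalize (∫ t in (0 : ℝ)..x, quotientIntegrand μ q γ t) = F
  unfold quotientIntegrand
  field_simp
  ring

/-! ### The quotient at infinity -/

theorem tendsto_quotientDamping_atTop {μ : ℝ} (hμ : -1 < μ) (q γ : ℝ) :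
    Tendsto (quotientDamping μ q γ) atTop (𝓝 (1 - γ)) := by
  unfold quotientDamping
  simpa using ((tendsto_besselRatio_atTop hμ).sub_const γ).add
    (tendsto_const_div_atTop (q - 2 * μ - 1))

theorem sharpQuotient_isBigO_atTop {μ q γ : ℝ} (hμ : -1 < μ) (hq : -1 < q) (hγ : γ < 1) :
    (fun x : ℝ => sharpQuotient μ q γ x -
        (1 / (1 - γ) + ((μ + 1 / 2) * (2 - γ) - q) / ((1 - γ) ^ 2 * x)))
      =O[atTop] (fun x : ℝ => 1 / x ^ 2) := by
  have hγ' : 0 < 1 - γ := by linarith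
  simp only [← div_div _ ((1 - γ) ^ 2)]
  -- `r` is the value for which the terms of order `1 / x` in the equation for
  -- `sharpQuotient μ q γ x - 1 / (1 - γ) - r / x` cancel
  generalize hr : ((μ + 1 / 2) * (2 - γ) - q) / (1 - γ) ^ 2 = r
  refine isBigO_inv_pow_of_hasDerivAt_damped (A := quotientDamping μ q γ)
    (B := fun x => (besselRatio μ x - (1 + (μ + 1 / 2) / x)) * (1 - 1 / (1 - γ) - r / x)
      + r * (1 - q + (μ + 1 / 2)) * (1 / x ^ 2)) 2 (half_pos hγ') ?_
    ((tendsto_quotientDamping_atTop hμ q γ).eventually_const_le (half_lt_self hγ')) ?_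
  · filter_upwards [eventually_gt_atTop 0] with x hx
    have hexpansion := ((hasDerivAt_inv hx.ne').const_mul r).const_add (1 / (1 - γ))
    refine ((hasDerivAt_sharpQuotient hq hx (besselI_pos (by linarith) hx).ne').sub
      hexpansion).congr_deriv ?_
    simp only [quotientDamping]
    generalize besselRatio μ x = k
    rw [← hr]
    field_simp
    ring
  · refine IsBigO.add ?_ ((isBigO_refl _ _).const_mul_left _)
    have hbounded := ((tendsto_const_div_atTop r).const_sub (1 - 1 / (1 - γ))).isBigO_one ℝ
    simpa using (besselRatio_sub_isBigO hμ).mul hbounded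

/-! ### Expansions at the origin -/

theorem isBigO_mul_sub_mul {ι : Type*} {l : Filter ι} {f f₀ g g₀ u : ι → ℝ}
    (hf : (fun x => f x - f₀ x) =O[l] u) (hg : (fun x => g x - g₀ x) =O[l] u)
    (hf₀ : f₀ =O[l] fun _ => (1 : ℝ)) (hg1 : g =O[l] fun _ => (1 : ℝ)) :
    (fun x => f x * g x - f₀ x * g₀ x) =O[l] u := by
  have hleft : (fun x => (f x - f₀ x) * g x) =O[l] u := by simpa using hf.mul hg1
  have hright : (fun x => f₀ x * (g x - g₀ x)) =O[l] u := by simpa using hf₀.mul hg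
  exact (hleft.add hright).congr_left fun x => by ring

theorem isBigO_div_sub {ι : Type*} {l : Filter ι} {f f₀ g g₀ p u : ι → ℝ} {c : ℝ}
    (hf : (fun x => f x - f₀ x) =O[l] u) (hg : (fun x => g x - g₀ x) =O[l] u)
    (hp : p =O[l] fun _ => (1 : ℝ)) (hfg : (fun x => f₀ x - p x * g₀ x) =O[l] u)
    (hgc : Tendsto g l (𝓝 c)) (hc : c ≠ 0) : (fun x => f x / g x - p x) =O[l] u := by
  have hpg : (fun x => p x * (g x - g₀ x)) =O[l] u := by simpa using hp.mul hg
  have hnum : (fun x => f x - p x * g x) =O[l] u :=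
    ((hf.sub hpg).add hfg).congr_left fun x => by ring
  have hquot : (fun x => (f x - p x * g x) * (g x)⁻¹) =O[l] u := by
    simpa using hnum.mul ((hgc.inv₀ hc).isBigO_one ℝ)
  refine hquot.congr' ?_ EventuallyEq.rfl
  filter_upwards [hgc.eventually_ne hc] with x hx
  field_simp

theorem isBigO_pow_mul_of_continuousAt {φ : ℝ → ℝ} (hφ : ContinuousAt φ 0) (n : ℕ) :
    (fun x => x ^ n * φ x) =O[𝓝 0] fun x => x ^ n := by
  simpa using (isBigO_refl (fun x : ℝ => x ^ n) (𝓝 0)).mul (hφ.tendsto.isBigO_one ℝ)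

theorem exp_neg_mul_sub_isBigO (γ : ℝ) :
    (fun t : ℝ => Real.exp (-(γ * t)) - (1 - γ * t + γ ^ 2 / 2 * t ^ 2))
      =O[𝓝 0] fun t => t ^ 3 := by
  have hlim : Tendsto (fun t : ℝ => -(γ * t)) (𝓝 0) (𝓝 0) :=
    Continuous.tendsto' (by fun_prop) _ _ (by simp)
  refine (((Real.exp_sub_sum_range_isBigO_pow 3).comp_tendsto hlim).trans
    ((isBigO_pow_mul_of_continuousAt (continuousAt_const (y := -γ ^ 3)) 3).congr_left
      fun t => ?_)).congr_left fun t => ?_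
  · simp only [Function.comp_apply]
    ring
  · simp only [Function.comp_apply, Finset.sum_range_succ, Finset.sum_range_zero, Nat.factorial]
    push_cast
    ring

theorem besselClifford_sq_div_four_sub_isBigO (α : ℝ) :
    (fun t : ℝ => besselClifford α (t ^ 2 / 4)
      - (besselCoeff α 0 + besselCoeff α 1 / 4 * t ^ 2)) =O[𝓝 0] fun t => t ^ 3 := by
  have hlim : Tendsto (fun t : ℝ => t ^ 2 / 4) (𝓝 0) (𝓝 0) :=
    Continuous.tendsto' (by fun_prop) _ _ (by simp)
  refine (((besselClifford_sub_sum_isBigO α 2).comp_tendsto hlim).trans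
    ((isBigO_pow_mul_of_continuousAt (φ := fun t => t / 16) (by fun_prop) 3).congr_left
      fun t => ?_)).congr_left fun t => ?_
  · simp only [Function.comp_apply]
    ring
  · simp only [Function.comp_apply, Finset.sum_range_succ, Finset.sum_range_zero]
    ring

theorem besselWeight_sub_isBigO {α : ℝ} (hα : α + 1 ≠ 0) (γ : ℝ) :
    (fun t => besselWeight α γ t - besselCoeff α 0 *
        (1 - γ * t + (γ ^ 2 / 2 + 1 / (4 * (α + 1))) * t ^ 2)) =O[𝓝 0] fun t => t ^ 3 := by
  have hcoeff : besselCoeff α 1 = besselCoeff α 0 / (α + 1) := by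
    have hone : besselCoeff α 1 = besselCoeff (α + 1) 0 := by
      simpa using succ_mul_besselCoeff_succ α 0
    rw [hone, eq_div_iff hα, mul_comm]
    simpa using (besselCoeff_eq_mul α 0).symm
  have hexp : Continuous fun t : ℝ => 1 - γ * t + γ ^ 2 / 2 * t ^ 2 := by fun_prop
  have hcliff : Continuous fun t : ℝ => besselClifford α (t ^ 2 / 4) :=
    (continuous_besselClifford α).comp (by fun_prop)
  have hprod := isBigO_mul_sub_mul (exp_neg_mul_sub_isBigO γ)
    (besselClifford_sq_div_four_sub_isBigO α) ((hexp.tendsto 0).isBigO_one ℝ)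
    ((hcliff.tendsto 0).isBigO_one ℝ)
  have htail := isBigO_pow_mul_of_continuousAt
    (φ := fun t => besselCoeff α 0 / (α + 1) / 4 * (-γ + γ ^ 2 / 2 * t)) (by fun_prop) 3
  refine (hprod.add htail).congr_left fun t => ?_
  rw [besselWeight, hcoeff]
  field_simp
  ring

theorem integral_rpow_mul_sum_pow {q x : ℝ} {n : ℕ} (hq : -1 < q) (hx : 0 < x) (a : Fin n → ℝ) :
    ∫ t in (0 : ℝ)..x, t ^ q * ∑ k, a k * t ^ (k : ℕ)
      = x ^ (q + 1) * ∑ k, a k * x ^ (k : ℕ) / (q + k + 1) := by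
  have hmonomial (k : Fin n) : ∫ t in (0 : ℝ)..x, t ^ q * (a k * t ^ (k : ℕ))
      = x ^ (q + 1) * (a k * x ^ (k : ℕ) / (q + k + 1)) := by
    have := Nat.cast_nonneg (α := ℝ) (k : ℕ)
    have hcongr : ∫ t in (0 : ℝ)..x, t ^ q * (a k * t ^ (k : ℕ))
        = ∫ t in (0 : ℝ)..x, a k * t ^ (q + (k : ℕ)) := by
      refine intervalIntegral.integral_congr_ae (Eventually.of_forall fun t ht => ?_)
      rw [Set.uIoc_of_le hx.le] at ht
      rw [Real.rpow_add_natCast ht.1.ne']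
      ring
    rw [hcongr, intervalIntegral.integral_const_mul, integral_rpow (Or.inl (by linarith)),
      Real.zero_rpow (by linarith), add_right_comm, Real.rpow_add_natCast hx.ne']
    ring
  simp only [Finset.mul_sum]
  rw [intervalIntegral.integral_finsetSum fun k _ =>
    intervalIntegrable_rpow_mul_of_continuous hq (by fun_prop) 0 x]
  exact Finset.sum_congr rfl fun k _ => hmonomial k

theorem isBigO_integral_of_isBigO_rpow {E : Type*} [NormedAddCommGroup E] [NormedSpace ℝ E]
    {ψ : ℝ → E} {s : ℝ} (hs : -1 < s) (hψ : ψ =O[𝓝[>] 0] fun t : ℝ => t ^ s) :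
    (fun x => ∫ t in (0 : ℝ)..x, ψ t) =O[𝓝[>] 0] fun x : ℝ => x ^ (s + 1) := by
  obtain ⟨C, hC⟩ := hψ.bound
  obtain ⟨δ, hδ, hC⟩ := mem_nhdsGT_iff_exists_Ioo_subset.mp hC
  refine IsBigO.of_bound (C / (s + 1)) ?_
  filter_upwards [Ioo_mem_nhdsGT hδ] with x hx
  have hbound : ‖∫ t in (0 : ℝ)..x, ψ t‖ ≤ ∫ t in (0 : ℝ)..x, C * t ^ s := by
    refine intervalIntegral.norm_integral_le_of_norm_le hx.1.le
      (Eventually.of_forall fun t ht => ?_)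
      ((intervalIntegral.intervalIntegrable_rpow' hs).const_mul C)
    rw [← Real.norm_of_nonneg (Real.rpow_nonneg ht.1.le s)]
    exact hC ⟨ht.1, ht.2.trans_lt hx.2⟩
  rw [Real.norm_of_nonneg (Real.rpow_nonneg hx.1.le _)]
  refine hbound.trans_eq ?_
  rw [intervalIntegral.integral_const_mul, integral_rpow (Or.inl hs),
    Real.zero_rpow (by linarith)]
  ring

theorem integral_rpow_mul_div_rpow_sub_isBigO {q : ℝ} (hq : -1 < q) {φ : ℝ → ℝ}
    (hφ : Continuous φ) {n : ℕ} {a : Fin n → ℝ}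
    (h : (fun t => φ t - ∑ k, a k * t ^ (k : ℕ)) =O[𝓝[>] 0] fun t => t ^ n) :
    (fun x => (∫ t in (0 : ℝ)..x, t ^ q * φ t) / x ^ (q + 1)
        - ∑ k, a k * x ^ (k : ℕ) / (q + k + 1)) =O[𝓝[>] 0] fun x => x ^ n := by
  have hremainder : (fun t => t ^ q * (φ t - ∑ k, a k * t ^ (k : ℕ)))
      =O[𝓝[>] 0] fun t => t ^ (q + n) := by
    refine ((isBigO_refl (fun t : ℝ => t ^ q) _).mul h).congr' EventuallyEq.rfl ?_
    filter_upwards [self_mem_nhdsWithin] with t ht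
    exact (Real.rpow_add_natCast (ne_of_gt ht) q n).symm
  have hintegral := isBigO_integral_of_isBigO_rpow
    (by linarith [n.cast_nonneg (α := ℝ)]) hremainder
  refine ((isBigO_refl (fun x : ℝ => (x ^ (q + 1))⁻¹) (𝓝[>] 0)).mul hintegral).congr' ?_ ?_
  all_goals
    filter_upwards [self_mem_nhdsWithin] with x (hx : 0 < x)
    have hxq := (Real.rpow_pos_of_pos hx (q + 1)).ne'
  · simp only [mul_sub]
    rw [intervalIntegral.integral_sub (intervalIntegrable_rpow_mul_of_continuous hq hφ 0 x)
      (intervalIntegrable_rpow_mul_of_continuous hq (by fun_prop) 0 x),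
      integral_rpow_mul_sum_pow hq hx]
    field_simp
  · rw [add_right_comm, Real.rpow_add_natCast hx.ne', inv_mul_cancel_left₀ hxq]

theorem integral_rpow_mul_besselWeight_sub_isBigO {α q : ℝ} (hα : α + 1 ≠ 0) (hq : -1 < q)
    (γ : ℝ) :
    (fun x => (∫ t in (0 : ℝ)..x, t ^ q * besselWeight α γ t) / x ^ (q + 1)
        - besselCoeff α 0 * (1 / (q + 1) - γ * x / (q + 2)
          + (γ ^ 2 / 2 + 1 / (4 * (α + 1))) * x ^ 2 / (q + 3))) =O[𝓝[>] 0] fun x => x ^ 3 := by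
  set a : Fin 3 → ℝ := fun k => besselCoeff α 0 * ![1, -γ, γ ^ 2 / 2 + 1 / (4 * (α + 1))] k
    with ha
  have hexpansion : (fun t => besselWeight α γ t - ∑ k, a k * t ^ (k : ℕ))
      =O[𝓝[>] 0] fun t => t ^ 3 := by
    refine ((besselWeight_sub_isBigO hα γ).mono nhdsWithin_le_nhds).congr_left fun t => ?_
    simp only [ha, Fin.sum_univ_three, Matrix.cons_val, Fin.isValue, Fin.val_zero, Fin.val_one,
      Fin.val_two]
    ring
  refine (integral_rpow_mul_div_rpow_sub_isBigO hq (continuous_besselWeight α γ)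
    hexpansion).congr_left fun x => ?_
  simp only [ha, Fin.sum_univ_three, Matrix.cons_val, Fin.isValue, Fin.val_zero, Fin.val_one,
    Fin.val_two, Nat.cast_zero, Nat.cast_one, Nat.cast_ofNat, zero_add, add_assoc,
    one_add_one_eq_two, two_add_one_eq_three]
  ring

theorem sharpQuotient_isBigO_nhdsGT_zero {μ q : ℝ} (hμ : -1 < μ) (hq : -1 < q) (γ : ℝ) :
    (fun x : ℝ => sharpQuotient μ q γ x -
        2 * (μ + 1) / (q + 1) *
          (1 + γ * x / (q + 2) +
            (γ ^ 2 / ((q + 2) * (q + 3)) + (q + 1) / (4 * (μ + 1) * (q + 3))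
              - 1 / (4 * (μ + 2))) * x ^ 2))
      =O[𝓝[>] (0 : ℝ)] (fun x : ℝ => x ^ 3) := by
  have hμ₁ : μ + 1 ≠ 0 := by linarith
  have hμ₂ : μ + 1 + 1 ≠ 0 := by linarith
  have hq₁ : q + 1 ≠ 0 := by linarith
  have hq₂ : q + 2 ≠ 0 := by linarith
  have hq₃ : q + 3 ≠ 0 := by linarith
  rw [show μ + 2 = μ + 1 + 1 by ring]
  generalize hv : γ ^ 2 / ((q + 2) * (q + 3)) + (q + 1) / (4 * (μ + 1) * (q + 3))
    - 1 / (4 * (μ + 1 + 1)) = v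
  have hnum := ((integral_rpow_mul_besselWeight_sub_isBigO hμ₁ hq γ).const_mul_left
    2).congr_left fun x => mul_sub _ _ _
  have hden := (besselWeight_sub_isBigO hμ₂ γ).mono (nhdsWithin_le_nhds (s := Set.Ioi 0))
  have hlim := ((continuous_besselWeight (μ + 1) γ).tendsto 0).mono_left
    (nhdsWithin_le_nhds (s := Set.Ioi 0))
  have hcont : Continuous fun x : ℝ =>
    2 * (μ + 1) / (q + 1) * (1 + γ * x / (q + 2) + v * x ^ 2) := by fun_prop
  refine (isBigO_div_sub hnum hden
    (((hcont.tendsto 0).isBigO_one ℝ).mono nhdsWithin_le_nhds) ?_ hlim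
    (besselWeight_pos (by linarith) γ 0).ne').congr' ?_ EventuallyEq.rfl
  · have htail := isBigO_pow_mul_of_continuousAt
      (φ := fun x => 2 * (μ + 1) / (q + 1) * besselCoeff (μ + 1) 0 *
        (γ * v - (γ ^ 2 / 2 + 1 / (4 * (μ + 1 + 1))) * (γ / (q + 2) + v * x))) (by fun_prop) 3
    refine (htail.mono nhdsWithin_le_nhds).congr_left fun x => ?_
    have hcoeff : besselCoeff μ 0 = (μ + 1) * besselCoeff (μ + 1) 0 := by
      simpa using besselCoeff_eq_mul μ 0
    rw [hcoeff, ← hv]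
    field_simp
    ring
  · filter_upwards [self_mem_nhdsWithin] with x hx
    rw [sharpQuotient_eq hx]

/-! ### The supremum -/

theorem tendsto_of_sub_isLittleO {ι : Type*} {l : Filter ι} {f u : ι → ℝ} {c d : ℝ}
    (hu : Tendsto u l (𝓝 0)) (h : (fun x => f x - (c + d * u x)) =o[l] u) :
    Tendsto f l (𝓝 c) := by
  simpa using (h.trans_tendsto hu).add ((hu.const_mul d).const_add c)

theorem eventually_lt_of_sub_isLittleO {ι : Type*} {l : Filter ι} {f u : ι → ℝ} {c d : ℝ}
    (hu : ∀ᶠ x in l, 0 < u x) (hd : 0 < d) (h : (fun x => f x - (c + d * u x)) =o[l] u) :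
    ∀ᶠ x in l, c < f x := by
  filter_upwards [h.bound (half_pos hd), hu] with x hx hux
  rw [Real.norm_of_nonneg hux.le, Real.norm_eq_abs] at hx
  linarith [(abs_le.mp hx).1, mul_pos hd hux]

theorem bddAbove_image_Ioi_of_tendsto {f : ℝ → ℝ} {a b c : ℝ} (hf : ContinuousOn f (Set.Ioi a))
    (ha : Tendsto f (𝓝[>] a) (𝓝 b)) (hc : Tendsto f atTop (𝓝 c)) :
    BddAbove (f '' Set.Ioi a) := by
  obtain ⟨u, hu, hleft⟩ := mem_nhdsGT_iff_exists_Ioo_subset.mp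
    (ha.eventually_le_const (lt_add_one b))
  obtain ⟨v, hright⟩ := eventually_atTop.mp (hc.eventually_le_const (lt_add_one c))
  have hmiddle : BddAbove (f '' Set.Icc u v) :=
    isCompact_Icc.bddAbove_image (hf.mono fun x hx => lt_of_lt_of_le hu hx.1)
  have hcover : Set.Ioi a ⊆ (Set.Ioo a u ∪ Set.Ici v) ∪ Set.Icc u v := fun x hx => by
    rcases lt_or_ge x u with hxu | hxu
    · exact Or.inl (Or.inl ⟨hx, hxu⟩)
    · exact (le_total v x).imp Or.inr fun hxv => ⟨hxu, hxv⟩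
  refine BddAbove.mono (Set.image_mono hcover) ?_
  rw [Set.image_union, Set.image_union]
  exact (BddAbove.union ⟨b + 1, Set.forall_mem_image.mpr fun x hx => hleft hx⟩
    ⟨c + 1, Set.forall_mem_image.mpr hright⟩).union hmiddle

theorem sharpQuotient_sub_isLittleO_nhdsGT_zero {μ q : ℝ} (hμ : -1 < μ) (hq : -1 < q) (γ : ℝ) :
    (fun x => sharpQuotient μ q γ x
      - (2 * (μ + 1) / (q + 1) + 2 * (μ + 1) / (q + 1) * (γ / (q + 2)) * x))
      =o[𝓝[>] 0] fun x => x := by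
  have hpow {n : ℕ} (hn : 1 < n) : (fun x : ℝ => x ^ n) =o[𝓝[>] 0] fun x => x :=
    (isLittleO_pow_id hn).mono nhdsWithin_le_nhds
  have hcubic := (sharpQuotient_isBigO_nhdsGT_zero hμ hq γ).trans_isLittleO
    (hpow (by norm_num : 1 < 3))
  refine (hcubic.add ((hpow one_lt_two).const_mul_left
    (2 * (μ + 1) / (q + 1) * (γ ^ 2 / ((q + 2) * (q + 3)) + (q + 1) / (4 * (μ + 1) * (q + 3))
      - 1 / (4 * (μ + 2)))))).congr_left fun x => ?_
  ring

theorem sharpQuotient_sub_isLittleO_atTop {μ q γ : ℝ} (hμ : -1 < μ) (hq : -1 < q) (hγ : γ < 1) :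
    (fun x => sharpQuotient μ q γ x
      - (1 / (1 - γ) + ((μ + 1 / 2) * (2 - γ) - q) / (1 - γ) ^ 2 * (1 / x)))
      =o[atTop] fun x => 1 / x := by
  have hpow : (fun x : ℝ => 1 / x ^ 2) =o[atTop] fun x => 1 / x := by
    refine ((isLittleO_pow_id (𝕜 := ℝ) one_lt_two).comp_tendsto
      (tendsto_const_div_atTop 1)).congr_left fun x => ?_
    simp
  refine ((sharpQuotient_isBigO_atTop hμ hq hγ).trans_isLittleO hpow).congr_left fun x => ?_
  rw [div_mul_div_comm, mul_one]

theorem bddAbove_sharpQuotient {μ q γ : ℝ} (hμ : -1 < μ) (hq : -1 < q) (hγ : γ < 1) :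
    BddAbove (sharpQuotient μ q γ '' Set.Ioi 0) := by
  have hcont : ContinuousOn (sharpQuotient μ q γ) (Set.Ioi 0) := fun x hx =>
    (hasDerivAt_sharpQuotient hq hx
      (besselI_pos (by linarith) hx).ne').continuousAt.continuousWithinAt
  exact bddAbove_image_Ioi_of_tendsto hcont
    (tendsto_of_sub_isLittleO nhdsWithin_le_nhds (sharpQuotient_sub_isLittleO_nhdsGT_zero hμ hq γ))
    (tendsto_of_sub_isLittleO (tendsto_const_div_atTop 1)
      (sharpQuotient_sub_isLittleO_atTop hμ hq hγ))

theorem sharpQuotient_le_sharpConstant {μ q γ x : ℝ} (hμ : -1 < μ) (hq : -1 < q) (hγ : γ < 1)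
    (hx : 0 < x) : sharpQuotient μ q γ x ≤ sharpConstant μ q γ :=
  le_csSup (bddAbove_sharpQuotient hμ hq hγ) (Set.mem_image_of_mem _ hx)

theorem two_mul_div_lt_sharpConstant {μ q γ : ℝ} (hμ : -1 < μ) (hq : -1 < q) (hγ₀ : 0 < γ)
    (hγ₁ : γ < 1) : 2 * (μ + 1) / (q + 1) < sharpConstant μ q γ := by
  have hslope : 0 < 2 * (μ + 1) / (q + 1) * (γ / (q + 2)) :=
    mul_pos (div_pos (by linarith) (by linarith)) (div_pos hγ₀ (by linarith))
  have hpos : ∀ᶠ x : ℝ in 𝓝[>] 0, 0 < x := self_mem_nhdsWithin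
  obtain ⟨x, hlt, hx⟩ := ((eventually_lt_of_sub_isLittleO hpos hslope
    (sharpQuotient_sub_isLittleO_nhdsGT_zero hμ hq γ)).and hpos).exists
  exact hlt.trans_le (sharpQuotient_le_sharpConstant hμ hq hγ₁ hx)

theorem one_div_one_sub_lt_sharpConstant {μ q γ : ℝ} (hμ : -1 < μ) (hq : -1 < q) (hγ : γ < 1)
    (hqμ : q < (μ + 1 / 2) * (2 - γ)) : 1 / (1 - γ) < sharpConstant μ q γ := by
  have hslope : 0 < ((μ + 1 / 2) * (2 - γ) - q) / (1 - γ) ^ 2 :=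
    div_pos (sub_pos.mpr hqμ) (pow_pos (sub_pos.mpr hγ) 2)
  have hpos : ∀ᶠ x : ℝ in atTop, 0 < 1 / x :=
    (eventually_gt_atTop 0).mono fun _ => one_div_pos.mpr
  obtain ⟨x, hlt, hx⟩ := ((eventually_lt_of_sub_isLittleO hpos hslope
    (sharpQuotient_sub_isLittleO_atTop hμ hq hγ)).and (eventually_gt_atTop 0)).exists
  exact hlt.trans_le (sharpQuotient_le_sharpConstant hμ hq hγ hx)

theorem mainTheorem8 (μ q γ : ℝ) (hμ : -1 < μ) (hq : -1 < q) (hγ0 : 0 < γ) (hγ1 : γ < 1) :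
    -- the integrals in the quotient converge
    (∀ x : ℝ, 0 < x →
      IntervalIntegrable (quotientIntegrand μ q γ) MeasureTheory.volume 0 x) ∧
    -- expansion as `x ↓ 0`
    (fun x : ℝ => sharpQuotient μ q γ x -
        2 * (μ + 1) / (q + 1) *
          (1 + γ * x / (q + 2) +
            (γ ^ 2 / ((q + 2) * (q + 3)) + (q + 1) / (4 * (μ + 1) * (q + 3))
              - 1 / (4 * (μ + 2))) * x ^ 2))
      =O[𝓝[>] (0 : ℝ)] (fun x : ℝ => x ^ 3) ∧
    -- expansion as `x → ∞`
    (fun x : ℝ => sharpQuotient μ q γ x -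
        (1 / (1 - γ) + ((μ + 1 / 2) * (2 - γ) - q) / ((1 - γ) ^ 2 * x)))
      =O[atTop] (fun x : ℝ => 1 / x ^ 2) ∧
    -- the supremum `M*` is finite, and exceeds the endpoint values
    BddAbove (sharpQuotient μ q γ '' Set.Ioi 0) ∧
    2 * (μ + 1) / (q + 1) < sharpConstant μ q γ ∧
    (q < (μ + 1 / 2) * (2 - γ) → 1 / (1 - γ) < sharpConstant μ q γ) := by
  exact ⟨fun x hx => intervalIntegrable_quotientIntegrand hq hx,
    sharpQuotient_isBigO_nhdsGT_zero hμ hq γ,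
    sharpQuotient_isBigO_atTop hμ hq hγ1,
    bddAbove_sharpQuotient hμ hq hγ1,
    two_mul_div_lt_sharpConstant hμ hq hγ0 hγ1,
    one_div_one_sub_lt_sharpConstant hμ hq hγ1⟩
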